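/- Let $H$ be a nonzero finite-dimensional complex Hilbert space and let $\Phi:B(H)\to B(H)$ be a quantum channel (a completely positive trace-preserving linear map). Let \[ \mathcal X_\Phi=\operatorname{span}\{X\in B(H):\exists\lambda\in\mathbb C,\ |\lambda|=1,\ \Phi(X)=\lambda X\} \] be its peripheral subspace, and let $\mathcal P$ be its peripheral projection, that is, the linear map on $B(H)$ with range $\mathcal X_\Phi$ which fixes every element of $\mathcal X_\Phi$ and is a limit $\mathcal P=\lim_{i\to\infty}\Phi^{n_i}$ for some non-decreasing sequence of non-negative integers $n_i$. Suppose that, for some orthogonal decomposition $H=H_0\oplus\bigoplus_{k=1}^K(H_{k,1}\otimes H_{k,2})$ with $\dim H_{k,1}=d_k$ (where $H_0=0$ is allowed), and for some full-rank states $\omega_k$ on $H_{k,2}$, \[ \mathcal X_\Phi=0\oplus\bigoplus_{k=1}^K B(H_{k,1})\otimes\omega_k . \] Then \[ \chi(\mathcal P)=\log\Big(\sum_{k=1}^K d_k\Big),\qquad I_c(\mathcal P)=\log\Big(\max_{1\le k\le K} d_k\Big). \] Here $H(\rho)=-\operatorname{tr}(\rho\log\rho)$ is the von Neumann entropy, with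 $\log$ the natural logarithm. For a bipartite state $\omega_{AB}$ with marginals $\omega_A,\omega_B$, put $I(A:B)_\omega=H(\omega_A)+H(\omega_B)-H(\omega_{AB})$ and $I(A\rangle B)_\omega=H(\omega_B)-H(\omega_{AB})$. The Holevo quantity is \[ \chi(\mathcal P)=\sup_{\rho_{XA}} I(X:B)_{(\mathrm{id}_X\otimes\mathcal P)(\rho_{XA})}, \] the supremum being over all classical--quantum states $\rho_{XA}=\sum_x p(x)\,|x\rangle\langle x|\otimes\rho_x$ with $x$ in a finite alphabet, $p$ a probability distribution and $\rho_x$ states on $H$. The coherent information is \[ I_c(\mathcal P)=\sup_{\rho_{A'A}} I(A'\rangle B)_{(\mathrm{id}_{A'}\otimes\mathcal P)(\rho_{A'A})}, \] the supremum being over all pure states $\rho_{A'A}$ on $H_{A'}\otimes H$ with $H_{A'}\cong H$. -/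

import Mathlib

open Filter Topology
open scoped Matrix Kronecker ComplexOrder

namespace QInfo

noncomputable section

/-- A state (density matrix) on the Hilbert space `ℂ^a`. -/
def IsState {a : Type*} [Fintype a] (ρ : Matrix a a ℂ) : Prop :=
  ρ.PosSemidef ∧ ρ.trace = 1

/-- A pure state `|ψ⟩⟨ψ|` with `ψ` a unit vector. -/
def IsPureState {a : Type*} [Fintype a] (ρ : Matrix a a ℂ) : Prop :=
  ∃ ψ : a → ℂ, star ψ ⬝ᵥ ψ = 1 ∧ ρ = Matrix.vecMulVec ψ (star ψ)

/-- The von Neumann entropy `H(ρ) = -tr(ρ log ρ)`. The logarithm is taken by functional calculus;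
since `Real.log 0 = 0`, the usual convention `0 log 0 = 0` is respected. -/
def entropy {a : Type*} [Fintype a] [DecidableEq a] (ρ : Matrix a a ℂ) : ℝ :=
  -(ρ * cfc Real.log ρ).trace.re

/-- The marginal `ω_A = tr_B ω_{AB}`. -/
def marginalA {a b : Type*} [Fintype b] (ω : Matrix (a × b) (a × b) ℂ) : Matrix a a ℂ :=
  Matrix.of fun i i' => ∑ j, ω (i, j) (i', j)

/-- The marginal `ω_B = tr_A ω_{AB}`. -/
def marginalB {a b : Type*} [Fintype a] (ω : Matrix (a × b) (a × b) ℂ) : Matrix b b ℂ :=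
  Matrix.of fun j j' => ∑ i, ω (i, j) (i, j')

/-- The quantum mutual information `I(A:B)_ω = H(ω_A) + H(ω_B) - H(ω_{AB})`. -/
def mutualInformation {a b : Type*} [Fintype a] [DecidableEq a] [Fintype b] [DecidableEq b]
    (ω : Matrix (a × b) (a × b) ℂ) : ℝ :=
  entropy (marginalA ω) + entropy (marginalB ω) - entropy ω

/-- The coherent information of a state, `I(A⟩B)_ω = H(ω_B) - H(ω_{AB})`. -/
def stateCoherentInformation {a b : Type*} [Fintype a] [DecidableEq a] [Fintype b] [DecidableEq b]
    (ω : Matrix (a × b) (a × b) ℂ) : ℝ :=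
  entropy (marginalB ω) - entropy ω

/-- The map `id_r ⊗ Φ`: regarding `M` as an `r × r` matrix of `n × n` blocks, apply `Φ` to each
block. -/
def idTensor (r : Type*) {n m : Type*} (Φ : Matrix n n ℂ →ₗ[ℂ] Matrix m m ℂ)
    (M : Matrix (r × n) (r × n) ℂ) : Matrix (r × m) (r × m) ℂ :=
  Matrix.of fun s t => Φ (Matrix.of fun i j => M (s.1, i) (t.1, j)) s.2 t.2

/-- The defining property of `id_r ⊗ Φ` on product operators. -/
theorem idTensor_kronecker (r : Type*) {n m : Type*} (Φ : Matrix n n ℂ →ₗ[ℂ] Matrix m m ℂ)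
    (A : Matrix r r ℂ) (B : Matrix n n ℂ) : idTensor r Φ (A ⊗ₖ B) = A ⊗ₖ Φ B := by
  ext ⟨a, i⟩ ⟨b, j⟩
  have h : (Matrix.of fun i' j' => (A ⊗ₖ B) (a, i') (b, j')) = A a b • B := by
    ext i' j'
    simp [Matrix.kroneckerMap_apply]
  simp only [idTensor, Matrix.of_apply]
  rw [h]
  simp [Matrix.kroneckerMap_apply]

/-- A quantum channel `B(ℂ^n) → B(ℂ^m)`: a completely positive trace-preserving linear map. -/
structure IsQuantumChannel {n m : Type*} [Fintype n] [Fintype m]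
    (Φ : Matrix n n ℂ →ₗ[ℂ] Matrix m m ℂ) : Prop where
  completelyPositive : ∀ (k : ℕ) (M : Matrix (Fin k × n) (Fin k × n) ℂ),
    M.PosSemidef → (idTensor (Fin k) Φ M).PosSemidef
  tracePreserving : ∀ X, (Φ X).trace = X.trace

/-- The peripheral subspace: the span of the eigenvectors of `Φ` with eigenvalue of modulus one. -/
def peripheralSubspace {n : Type*} (Φ : Matrix n n ℂ →ₗ[ℂ] Matrix n n ℂ) :
    Submodule ℂ (Matrix n n ℂ) :=
  Submodule.span ℂ {X | ∃ z : ℂ, ‖z‖ = 1 ∧ Φ X = z • X}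

/-- `P` is the peripheral projection of `Φ`: its range is the peripheral subspace, it fixes that
subspace pointwise, and it is the limit of a sequence of powers of `Φ` with non-decreasing
exponents (in finite dimension pointwise convergence is norm convergence). -/
structure IsPeripheralProjection {n : Type*} (Φ P : Matrix n n ℂ →ₗ[ℂ] Matrix n n ℂ) : Prop where
  range_eq : LinearMap.range P = peripheralSubspace Φ
  exists_tendsto : ∃ e : ℕ → ℕ, Monotone e ∧
    ∀ X, Tendsto (fun i => (Φ ^ e i) X) atTop (𝓝 (P X))
  fixes : ∀ X ∈ peripheralSubspace Φ, P X = X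

/-- The classical-quantum state `∑ x, p(x) |x⟩⟨x| ⊗ ρ_x`. -/
def cqState {N : ℕ} {n : Type*} (p : Fin N → ℝ) (ρ : Fin N → Matrix n n ℂ) :
    Matrix (Fin N × n) (Fin N × n) ℂ :=
  ∑ x, (p x : ℂ) • (Matrix.single x x (1 : ℂ) ⊗ₖ ρ x)

/-- A finite ensemble of states on `ℂ^n` indexed by an `N`-letter alphabet. -/
structure Ensemble (N : ℕ) (n : Type*) [Fintype n] where
  p : Fin N → ℝ
  p_nonneg : ∀ x, 0 ≤ p x
  p_sum : ∑ x, p x = 1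
  ρ : Fin N → Matrix n n ℂ
  ρ_isState : ∀ x, IsState (ρ x)

/-- The Holevo quantity `χ(Φ) = sup I(X:B)_{(id_X ⊗ Φ)(ρ_{XA})}` over all classical-quantum states
`ρ_{XA}` with a finite alphabet. The supremum is taken in `[-∞, ∞]`. -/
def holevoQuantity {n m : Type*} [Fintype n] [Fintype m] [DecidableEq m]
    (Φ : Matrix n n ℂ →ₗ[ℂ] Matrix m m ℂ) : EReal :=
  ⨆ (N : ℕ) (E : Ensemble N n),
    ((mutualInformation (idTensor (Fin N) Φ (cqState E.p E.ρ)) : ℝ) : EReal)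

/-- The coherent information `I_c(Φ) = sup I(A'⟩B)_{(id_{A'} ⊗ Φ)(ρ_{A'A})}` over all pure states
`ρ_{A'A}` with `H_{A'} ≅ H_A`. The supremum is taken in `[-∞, ∞]`. -/
def coherentInformation {n m : Type*} [Fintype n] [DecidableEq n] [Fintype m] [DecidableEq m]
    (Φ : Matrix n n ℂ →ₗ[ℂ] Matrix m m ℂ) : EReal :=
  ⨆ (ρ : Matrix (n × n) (n × n) ℂ) (_ : IsPureState ρ),
    ((stateCoherentInformation (idTensor n Φ ρ) : ℝ) : EReal)

/-- The subspace `0 ⊕ ⨁ k, M_{d k} ⊗ ω k` of `B(ℂ^n)`, as a set. The decomposition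
`ℂ^n = H₀ ⊕ ⨁ k, ℂ^{d k} ⊗ ℂ^{m k}` is given by the isometry `V` from `⨁ k, ℂ^{d k} ⊗ ℂ^{m k}`
into `ℂ^n`, with `H₀` the orthogonal complement of the range of `V`. -/
def blockSubspace {n : Type*} {K : ℕ} {d m : Fin K → ℕ}
    (V : Matrix n (Σ k, Fin (d k) × Fin (m k)) ℂ)
    (ω : ∀ k, Matrix (Fin (m k)) (Fin (m k)) ℂ) : Set (Matrix n n ℂ) :=
  {Y | ∃ X : ∀ k, Matrix (Fin (d k)) (Fin (d k)) ℂ,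
    Y = V * Matrix.blockDiagonal' (fun k => X k ⊗ₖ ω k) * Vᴴ}

end

end QInfo

/-!
The peripheral projection `P` is a limit of powers of `Φ`, hence itself a channel, and it is a
projection onto the block operators `0 ⊕ ⨁ k, X k ⊗ ω k`. On such operators the states `ω k` only
contribute a term to the entropy that is linear in the traces of the `X k`, and this term cancels
both in the mutual information of classical-quantum states and in the coherent information. What
remains is the entropy of `⨁ k, X k`.

Upper bounds: a state on `⨁ k, ℂ^(d k)` has entropy at most `log (∑ k, d k)`, and the coherent
information splits into a sum over the blocks, the `k`-th term being at most `log (d k)` times the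
weight of the block. Lower bounds: the uniform ensemble of basis states consists of fixed points of
`P`. For the coherent information the input has to be pure, whereas the fixed points `|φ⟩⟨φ| ⊗ ω k`
are not in general. But a pure state `τ` below a multiple of such a fixed point is mapped to it: by
positivity `P τ` lies below the same multiple, and the only block state there is `|φ⟩⟨φ| ⊗ ω k`. A
maximally entangled `φ` attains `log (d k)`.
-/

namespace QInfo

open scoped MatrixOrder

section Entropy

variable {a b : Type*} [Fintype a] [DecidableEq a] [Fintype b] [DecidableEq b]

theorem entropy_eq_sum_eigenvalues {M : Matrix a a ℂ} (hM : M.IsHermitian) :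
    entropy M = ∑ i, Real.negMulLog (hM.eigenvalues i) := by
  have hU : star (hM.eigenvectorUnitary : Matrix a a ℂ) * hM.eigenvectorUnitary = 1 :=
    Unitary.coe_star_mul_self _
  have hlog : M * cfc Real.log M = hM.eigenvectorUnitary *
      Matrix.diagonal (fun i => ((hM.eigenvalues i * Real.log (hM.eigenvalues i) : ℝ) : ℂ)) *
      star (hM.eigenvectorUnitary : Matrix a a ℂ) := by
    rw [hM.cfc_eq, Matrix.IsHermitian.cfc]
    conv_lhs => enter [1]; rw [hM.spectral_theorem]
    rw [← map_mul, Matrix.diagonal_mul_diagonal, Unitary.conjStarAlgAut_apply]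
    simp
  rw [entropy, hlog, Matrix.trace_mul_comm, ← Matrix.mul_assoc, hU, one_mul, Matrix.trace_diagonal]
  simp only [Complex.re_sum, Complex.ofReal_re, Real.negMulLog_def, neg_mul, Finset.sum_neg_distrib]

theorem entropy_eq_sum_roots_charpoly {M : Matrix a a ℂ} (hM : M.IsHermitian) :
    entropy M = (M.charpoly.roots.map fun z => Real.negMulLog z.re).sum := by
  rw [entropy_eq_sum_eigenvalues hM, hM.roots_charpoly_eq_eigenvalues, Multiset.map_map]
  rfl

/- The characteristic polynomials of `A * B` and `B * A` differ by a power of `X`, whose roots are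
zero and contribute nothing to the entropy. -/
theorem entropy_mul_comm {A : Matrix a b ℂ} {B : Matrix b a ℂ} (hAB : (A * B).IsHermitian)
    (hBA : (B * A).IsHermitian) : entropy (A * B) = entropy (B * A) := by
  have hroots (k : ℕ) {p : Polynomial ℂ} (hp : p.Monic) :
      ((Polynomial.X ^ k * p).roots.map fun z : ℂ => Real.negMulLog z.re).sum =
        (p.roots.map fun z : ℂ => Real.negMulLog z.re).sum := by
    rw [Polynomial.roots_mul (mul_ne_zero (pow_ne_zero _ Polynomial.X_ne_zero) hp.ne_zero),
      Polynomial.roots_X_pow]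
    simp [Multiset.nsmul_singleton]
  rw [entropy_eq_sum_roots_charpoly hAB, entropy_eq_sum_roots_charpoly hBA,
    ← hroots (Fintype.card b) (Matrix.charpoly_monic _), Matrix.charpoly_mul_comm',
    hroots _ (Matrix.charpoly_monic _)]

theorem entropy_conj_of_isometry {V : Matrix a b ℂ} (hV : Vᴴ * V = 1) {M : Matrix b b ℂ}
    (hM : M.IsHermitian) : entropy (V * M * Vᴴ) = entropy M := by
  have h : Vᴴ * (V * M) = M := by rw [← Matrix.mul_assoc, hV, Matrix.one_mul]
  rw [entropy_mul_comm (Matrix.isHermitian_mul_mul_conjTranspose _ hM) (by rwa [h]), h]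

theorem entropy_submatrix_equiv {M : Matrix a a ℂ} (hM : M.IsHermitian) (σ : b ≃ a) :
    entropy (M.submatrix σ σ) = entropy M := by
  rw [entropy_eq_sum_roots_charpoly (hM.submatrix σ), entropy_eq_sum_roots_charpoly hM,
    ← Matrix.charpoly_reindex σ.symm M, Matrix.reindex_apply, Equiv.symm_symm]

omit [Fintype a] in
theorem isHermitian_diagonal_ofReal (l : a → ℝ) :
    (Matrix.diagonal fun i => (l i : ℂ)).IsHermitian :=
  Matrix.isHermitian_diagonal_of_self_adjoint _ (by ext i; simp)

theorem entropy_diagonal (l : a → ℝ) :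
    entropy (Matrix.diagonal fun i => (l i : ℂ)) = ∑ i, Real.negMulLog (l i) := by
  rw [entropy_eq_sum_roots_charpoly (isHermitian_diagonal_ofReal l), Matrix.charpoly_diagonal,
    Polynomial.roots_prod]
  · simp
  · simp [Finset.prod_ne_zero_iff, Polynomial.X_sub_C_ne_zero]

theorem entropy_conj_diagonal {U : Matrix a b ℂ} (hU : Uᴴ * U = 1) (l : b → ℝ) :
    entropy (U * Matrix.diagonal (fun i => (l i : ℂ)) * Uᴴ) = ∑ i, Real.negMulLog (l i) := by
  rw [entropy_conj_of_isometry hU (isHermitian_diagonal_ofReal l), entropy_diagonal]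

omit [DecidableEq a] in
theorem trace_conj_of_isometry {U : Matrix a b ℂ} (hU : Uᴴ * U = 1) (M : Matrix b b ℂ) :
    (U * M * Uᴴ).trace = M.trace := by
  rw [Matrix.trace_mul_comm, ← Matrix.mul_assoc, hU, Matrix.one_mul]

theorem exists_eq_conj_diagonal {M : Matrix a a ℂ} (hM : M.IsHermitian) :
    ∃ (U : Matrix a a ℂ) (l : a → ℝ), Uᴴ * U = 1 ∧
      M = U * Matrix.diagonal (fun i => (l i : ℂ)) * Uᴴ := by
  refine ⟨hM.eigenvectorUnitary, hM.eigenvalues, Unitary.coe_star_mul_self _, ?_⟩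
  conv_lhs => rw [hM.spectral_theorem, Unitary.conjStarAlgAut_apply]
  rfl

theorem entropy_kronecker {A : Matrix a a ℂ} {B : Matrix b b ℂ} (hA : A.IsHermitian)
    (hB : B.IsHermitian) :
    entropy (A ⊗ₖ B) = B.trace.re * entropy A + A.trace.re * entropy B := by
  obtain ⟨U, l, hU, rfl⟩ := exists_eq_conj_diagonal hA
  obtain ⟨W, μ, hW, rfl⟩ := exists_eq_conj_diagonal hB
  have hUW : (U ⊗ₖ W)ᴴ * (U ⊗ₖ W) = 1 := by
    rw [Matrix.conjTranspose_kronecker, ← Matrix.mul_kronecker_mul, hU, hW,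
      Matrix.one_kronecker_one]
  have hdiag : (U * Matrix.diagonal (fun i => (l i : ℂ)) * Uᴴ) ⊗ₖ
        (W * Matrix.diagonal (fun j => (μ j : ℂ)) * Wᴴ) =
      (U ⊗ₖ W) * Matrix.diagonal (fun s => ((l s.1 * μ s.2 : ℝ) : ℂ)) * (U ⊗ₖ W)ᴴ := by
    simp only [Matrix.mul_kronecker_mul, Matrix.diagonal_kronecker_diagonal,
      Matrix.conjTranspose_kronecker, Complex.ofReal_mul]
  rw [hdiag, entropy_conj_diagonal hUW, entropy_conj_diagonal hU, entropy_conj_diagonal hW,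
    trace_conj_of_isometry hU, trace_conj_of_isometry hW]
  simp only [Matrix.trace_diagonal, Complex.re_sum, Complex.ofReal_re, Fintype.sum_prod_type,
    Real.negMulLog_mul, Finset.sum_add_distrib, ← Finset.sum_mul, ← Finset.mul_sum]

theorem entropy_blockDiagonal' {ι : Type*} {g : ι → Type*} [Fintype ι] [DecidableEq ι]
    [∀ k, Fintype (g k)] [∀ k, DecidableEq (g k)] {M : ∀ k, Matrix (g k) (g k) ℂ}
    (hM : ∀ k, (M k).IsHermitian) :
    entropy (Matrix.blockDiagonal' M) = ∑ k, entropy (M k) := by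
  choose U l hU hUM using fun k => exists_eq_conj_diagonal (hM k)
  have hU' : (Matrix.blockDiagonal' U)ᴴ * Matrix.blockDiagonal' U = 1 := by
    rw [Matrix.blockDiagonal'_conjTranspose, ← Matrix.blockDiagonal'_mul]
    simp only [hU]
    exact Matrix.blockDiagonal'_one
  have hdiag : Matrix.blockDiagonal' M = Matrix.blockDiagonal' U *
      Matrix.diagonal (fun s => (l s.1 s.2 : ℂ)) * (Matrix.blockDiagonal' U)ᴴ := by
    rw [← Matrix.blockDiagonal'_diagonal fun k i => (l k i : ℂ),
      Matrix.blockDiagonal'_conjTranspose, ← Matrix.blockDiagonal'_mul,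
      ← Matrix.blockDiagonal'_mul]
    exact congrArg _ (funext hUM)
  rw [hdiag, entropy_conj_diagonal hU', Fintype.sum_sigma]
  refine Finset.sum_congr rfl fun k _ => ?_
  rw [hUM k, entropy_conj_diagonal (hU k)]

theorem entropy_smul {M : Matrix a a ℂ} (hM : M.IsHermitian) (c : ℝ) :
    entropy ((c : ℂ) • M) = M.trace.re * Real.negMulLog c + c * entropy M := by
  obtain ⟨U, l, hU, rfl⟩ := exists_eq_conj_diagonal hM
  have hdiag : (c : ℂ) • (U * Matrix.diagonal (fun i => (l i : ℂ)) * Uᴴ) =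
      U * Matrix.diagonal (fun i => ((c * l i : ℝ) : ℂ)) * Uᴴ := by
    rw [← Matrix.smul_mul, ← Matrix.mul_smul, ← Matrix.diagonal_smul]
    simp only [Pi.smul_def, smul_eq_mul, Complex.ofReal_mul]
  rw [hdiag, entropy_conj_diagonal hU, entropy_conj_diagonal hU, trace_conj_of_isometry hU]
  simp only [Matrix.trace_diagonal, Complex.re_sum, Complex.ofReal_re, Real.negMulLog_mul,
    Finset.sum_add_distrib, ← Finset.sum_mul, ← Finset.mul_sum]

@[simp]
theorem entropy_zero : entropy (0 : Matrix a a ℂ) = 0 := by simp [entropy]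

variable (a) in
theorem entropy_maximallyMixed :
    entropy ((Fintype.card a : ℂ)⁻¹ • (1 : Matrix a a ℂ)) = Real.log (Fintype.card a) := by
  have hdiag : (Fintype.card a : ℂ)⁻¹ • (1 : Matrix a a ℂ) =
      Matrix.diagonal fun _ => (((Fintype.card a : ℝ)⁻¹ : ℝ) : ℂ) := by
    ext i j
    simp [Matrix.one_apply, Matrix.diagonal_apply]
  rw [hdiag, entropy_diagonal, Finset.sum_const, Finset.card_univ, nsmul_eq_mul, Real.negMulLog,
    Real.log_inv]
  rcases isEmpty_or_nonempty a with h | h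
  · simp
  · field_simp

omit [DecidableEq a] in
theorem sum_negMulLog_le_negMulLog_sum_add {l : a → ℝ} (hl : ∀ i, 0 ≤ l i) :
    ∑ i, Real.negMulLog (l i) ≤
      Real.negMulLog (∑ i, l i) + (∑ i, l i) * Real.log (Fintype.card a) := by
  rcases isEmpty_or_nonempty a with h | h
  · simp
  have hcard : (0 : ℝ) < Fintype.card a := by exact_mod_cast Fintype.card_pos
  have jensen := Real.concaveOn_negMulLog.le_map_sum (t := Finset.univ) (p := l)
    (w := fun _ => (Fintype.card a : ℝ)⁻¹) (fun _ _ => by positivity)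
    (by simp [hcard.ne']) (fun i _ => hl i)
  simp only [smul_eq_mul, ← Finset.mul_sum] at jensen
  rw [Real.negMulLog_mul, inv_mul_le_iff₀ hcard] at jensen
  refine jensen.trans_eq ?_
  rw [Real.negMulLog, Real.log_inv]
  field_simp
  ring

omit [DecidableEq a] in
theorem negMulLog_sum_le_sum_negMulLog {l : a → ℝ} (hl : ∀ i, 0 ≤ l i) :
    Real.negMulLog (∑ i, l i) ≤ ∑ i, Real.negMulLog (l i) := by
  simp only [Real.negMulLog, neg_mul, Finset.sum_neg_distrib, neg_le_neg_iff, Finset.sum_mul]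
  refine Finset.sum_le_sum fun i hi => ?_
  rcases (hl i).eq_or_lt with h | h
  · simp [← h]
  · exact mul_le_mul_of_nonneg_left
      (Real.log_le_log h (Finset.single_le_sum (fun j _ => hl j) hi)) (hl i)

theorem sum_eigenvalues_eq_trace_re {M : Matrix a a ℂ} (hM : M.IsHermitian) :
    ∑ i, hM.eigenvalues i = M.trace.re := by
  rw [hM.trace_eq_sum_eigenvalues]
  simp

theorem entropy_le_negMulLog_trace_add {M : Matrix a a ℂ} (hM : M.PosSemidef) :
    entropy M ≤ Real.negMulLog M.trace.re + M.trace.re * Real.log (Fintype.card a) := by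
  rw [entropy_eq_sum_eigenvalues hM.1, ← sum_eigenvalues_eq_trace_re hM.1]
  exact sum_negMulLog_le_negMulLog_sum_add hM.eigenvalues_nonneg

theorem negMulLog_trace_le_entropy {M : Matrix a a ℂ} (hM : M.PosSemidef) :
    Real.negMulLog M.trace.re ≤ entropy M := by
  rw [entropy_eq_sum_eigenvalues hM.1, ← sum_eigenvalues_eq_trace_re hM.1]
  exact negMulLog_sum_le_sum_negMulLog hM.eigenvalues_nonneg

theorem IsState.entropy_le_log_card {ρ : Matrix a a ℂ} (hρ : IsState ρ) :
    entropy ρ ≤ Real.log (Fintype.card a) := by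
  simpa [hρ.2] using entropy_le_negMulLog_trace_add hρ.1

theorem IsState.entropy_nonneg {ρ : Matrix a a ℂ} (hρ : IsState ρ) : 0 ≤ entropy ρ := by
  simpa [hρ.2] using negMulLog_trace_le_entropy hρ.1

end Entropy

section States

variable {a : Type*} [Fintype a]

theorem IsState.nonempty {ρ : Matrix a a ℂ} (hρ : IsState ρ) : Nonempty a := by
  by_contra h
  rw [not_nonempty_iff] at h
  simpa [Matrix.trace] using hρ.2

theorem isPureState_inv_smul_vecMulVec {v : a → ℂ} (hv : v ≠ 0) :
    IsPureState ((star v ⬝ᵥ v)⁻¹ • Matrix.vecMulVec v (star v)) := by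
  obtain ⟨q, hq, hqv⟩ : ∃ q : ℝ, 0 < q ∧ star v ⬝ᵥ v = (q : ℂ) :=
    have h := Complex.pos_iff.1 (Matrix.dotProduct_star_self_pos_iff.2 hv)
    ⟨_, h.1, Complex.ext rfl h.2.symm⟩
  have hsqrt : (((√q)⁻¹ : ℝ) : ℂ) * (((√q)⁻¹ : ℝ) : ℂ) = (q : ℂ)⁻¹ := by
    rw [← Complex.ofReal_mul, ← mul_inv, Real.mul_self_sqrt hq.le, Complex.ofReal_inv]
  refine ⟨(((√q)⁻¹ : ℝ) : ℂ) • v, ?_, ?_⟩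
  · rw [star_smul, smul_dotProduct, dotProduct_smul, hqv, smul_eq_mul, smul_eq_mul, ← mul_assoc,
      Complex.star_def, Complex.conj_ofReal, hsqrt,
      inv_mul_cancel₀ (Complex.ofReal_ne_zero.2 hq.ne')]
  · rw [hqv, star_smul, Matrix.smul_vecMulVec, Matrix.vecMulVec_smul, smul_smul, Complex.star_def,
      Complex.conj_ofReal, hsqrt]

theorem isPureState_single [DecidableEq a] (i : a) : IsPureState (Matrix.single i i (1 : ℂ)) :=
  ⟨Pi.single i 1, by simp, by
    rw [Matrix.single_eq_single_vecMulVec_single, Pi.star_single, star_one]⟩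

theorem IsPureState.isState {ρ : Matrix a a ℂ} (hρ : IsPureState ρ) : IsState ρ := by
  obtain ⟨ψ, hψ, rfl⟩ := hρ
  refine ⟨Matrix.posSemidef_vecMulVec_self_star ψ, ?_⟩
  rw [Matrix.trace_vecMulVec, dotProduct_comm, hψ]

theorem IsPureState.mul_mul_self {ρ : Matrix a a ℂ} (hρ : IsPureState ρ) (M : Matrix a a ℂ) :
    ρ * M * ρ = (ρ * M).trace • ρ := by
  obtain ⟨ψ, -, rfl⟩ := hρ
  rw [Matrix.vecMulVec_mul, Matrix.vecMulVec_mul_vecMulVec, Matrix.vecMulVec_smul,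
    Matrix.trace_vecMulVec, dotProduct_comm ψ]

theorem IsPureState.mul_self {ρ : Matrix a a ℂ} (hρ : IsPureState ρ) : ρ * ρ = ρ := by
  classical
  simpa [hρ.isState.2] using hρ.mul_mul_self 1

theorem IsPureState.entropy_eq_zero [DecidableEq a] {ρ : Matrix a a ℂ} (hρ : IsPureState ρ) :
    entropy ρ = 0 := by
  obtain ⟨ψ, hψ, rfl⟩ := hρ
  let A : Matrix a Unit ℂ := Matrix.replicateCol Unit ψ
  have hA : Aᴴ * A = 1 := by
    ext i j
    simpa [A, Matrix.mul_apply, dotProduct] using hψ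
  have hψA : Matrix.vecMulVec ψ (star ψ) =
      A * Matrix.diagonal (fun _ : Unit => ((1 : ℝ) : ℂ)) * Aᴴ := by
    simp [A, Matrix.vecMulVec_eq Unit]
  rw [hψA, entropy_conj_diagonal hA, Finset.sum_const, Real.negMulLog_one, smul_zero]

theorem mul_eq_zero_of_le {X Y C : Matrix a a ℂ} (hX : 0 ≤ X) (hXY : X ≤ Y) (hYC : Y * C = 0) :
    X * C = 0 := by
  classical
  have hle : Cᴴ * X * C ≤ 0 := by
    have h := (Matrix.le_iff.1 hXY).conjTranspose_mul_mul_same C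
    rwa [mul_sub, sub_mul, mul_assoc _ Y, hYC, mul_zero, ← Matrix.le_iff] at h
  have hge : 0 ≤ Cᴴ * X * C :=
    Matrix.nonneg_iff_posSemidef.2
      ((Matrix.nonneg_iff_posSemidef.1 hX).conjTranspose_mul_mul_same C)
  obtain ⟨B, rfl⟩ := CStarAlgebra.nonneg_iff_eq_star_mul_self.1 hX
  rw [Matrix.star_eq_conjTranspose] at hle hge ⊢
  have hBC : (B * C)ᴴ * (B * C) = 0 := by
    rw [Matrix.conjTranspose_mul, ← mul_assoc, mul_assoc Cᴴ]
    exact le_antisymm hle hge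
  rw [mul_assoc, Matrix.conjTranspose_mul_self_eq_zero.1 hBC, mul_zero]

theorem IsPureState.eq_of_le {ρ X : Matrix a a ℂ} (hρ : IsPureState ρ) (hX : IsState X) {c : ℂ}
    (h : X ≤ c • ρ) : X = ρ := by
  classical
  have hright : X * ρ = X := by
    have hker := mul_eq_zero_of_le (Matrix.nonneg_iff_posSemidef.2 hX.1) h (C := 1 - ρ)
      (by rw [Matrix.smul_mul, mul_sub, mul_one, hρ.mul_self, sub_self, smul_zero])
    rwa [mul_sub, mul_one, sub_eq_zero, eq_comm] at hker
  have hleft : ρ * X = X := by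
    have h := congrArg Matrix.conjTranspose hright
    rwa [Matrix.conjTranspose_mul, hρ.isState.1.1, hX.1.1] at h
  calc X = ρ * X * ρ := by rw [hleft, hright]
    _ = (ρ * X).trace • ρ := hρ.mul_mul_self X
    _ = ρ := by rw [hleft, hX.2, one_smul]

theorem IsState.exists_isPureState_le {σ : Matrix a a ℂ} (hσ : IsState σ) :
    ∃ ρ, IsPureState ρ ∧ ∃ c : ℂ, ρ ≤ c • σ := by
  obtain ⟨m, v, hv⟩ := Matrix.posSemidef_iff_eq_sum_vecMulVec.1 hσ.1
  obtain ⟨y, hy⟩ : ∃ y, v y ≠ 0 := by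
    by_contra! h
    simpa [hv, h] using hσ.2
  have hle : Matrix.vecMulVec (v y) (star (v y)) ≤ σ := by
    rw [hv]
    exact Finset.single_le_sum (f := fun i => Matrix.vecMulVec (v i) (star (v i)))
      (fun i _ => Matrix.nonneg_iff_posSemidef.2 (Matrix.posSemidef_vecMulVec_self_star _))
      (Finset.mem_univ y)
  refine ⟨_, isPureState_inv_smul_vecMulVec hy, (star (v y) ⬝ᵥ v y)⁻¹, ?_⟩
  rw [Matrix.le_iff, ← smul_sub]
  exact (Matrix.le_iff.1 hle).smul (inv_nonneg.2 (dotProduct_star_self_nonneg _))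

theorem IsPureState.blockDiagonal'_single {ι : Type*} {g : ι → Type*} [Fintype ι] [DecidableEq ι]
    [∀ k, Fintype (g k)] {k : ι} {ρ : Matrix (g k) (g k) ℂ} (hρ : IsPureState ρ) :
    IsPureState (Matrix.blockDiagonal' (Pi.single k ρ : ∀ k, Matrix (g k) (g k) ℂ)) := by
  obtain ⟨ψ, hψ, rfl⟩ := hρ
  refine ⟨fun s => (Pi.single k ψ : ∀ k, g k → ℂ) s.1 s.2, ?_, ?_⟩
  · rw [dotProduct, Fintype.sum_sigma, Finset.sum_eq_single k]
    · simpa [dotProduct] using hψ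
    · intro l _ hl
      simp [Pi.single_eq_of_ne hl]
    · simp
  · ext ⟨l, i⟩ ⟨l', j⟩
    rw [Matrix.blockDiagonal'_apply]
    rcases eq_or_ne l k with rfl | hl
    · rcases eq_or_ne l l' with rfl | hl'
      · simp [Matrix.vecMulVec_apply]
      · simp [Matrix.vecMulVec_apply, hl']
    · simp [Matrix.vecMulVec_apply, Pi.single_eq_of_ne hl]

end States

section Marginals

variable {a b : Type*}

theorem marginalA_kronecker [Fintype b] (A : Matrix a a ℂ) (B : Matrix b b ℂ) :
    marginalA (A ⊗ₖ B) = B.trace • A := by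
  ext i j
  simp [marginalA, Matrix.trace, Finset.mul_sum, mul_comm]

theorem marginalB_zero [Fintype a] : marginalB (0 : Matrix (a × b) (a × b) ℂ) = 0 := by
  ext i j
  simp [marginalB]

theorem trace_marginalB [Fintype a] [Fintype b] (M : Matrix (a × b) (a × b) ℂ) :
    (marginalB M).trace = M.trace := by
  simp only [Matrix.trace, Matrix.diag, marginalB, Matrix.of_apply, Fintype.sum_prod_type]
  exact Finset.sum_comm

theorem marginalA_eq_sum_submatrix [Fintype b] (M : Matrix (a × b) (a × b) ℂ) :
    marginalA M = ∑ j, M.submatrix (fun i => (i, j)) fun i => (i, j) := by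
  ext i i'
  simp [marginalA, Matrix.sum_apply]

theorem posSemidef_marginalA [Fintype b] {M : Matrix (a × b) (a × b) ℂ} (hM : M.PosSemidef) :
    (marginalA M).PosSemidef := by
  rw [marginalA_eq_sum_submatrix]
  exact Matrix.posSemidef_sum _ fun j _ => hM.submatrix _

theorem marginalB_eq_sum_submatrix [Fintype a] (M : Matrix (a × b) (a × b) ℂ) :
    marginalB M = ∑ i, M.submatrix (Prod.mk i) (Prod.mk i) := by
  ext j j'
  simp [marginalB, Matrix.sum_apply]

theorem posSemidef_marginalB [Fintype a] {M : Matrix (a × b) (a × b) ℂ} (hM : M.PosSemidef) :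
    (marginalB M).PosSemidef := by
  rw [marginalB_eq_sum_submatrix]
  exact Matrix.posSemidef_sum _ fun i _ => hM.submatrix _

end Marginals

section Channels

variable {n m r : Type*}

/-- The map `id_r ⊗ Φ` of `idTensor`, bundled as a linear map. -/
def idTensorLinearMap (r : Type*) (Φ : Matrix n n ℂ →ₗ[ℂ] Matrix m m ℂ) :
    Matrix (r × n) (r × n) ℂ →ₗ[ℂ] Matrix (r × m) (r × m) ℂ where
  toFun := idTensor r Φ
  map_add' M N := by
    ext s t
    exact congrFun₂ (map_add Φ (Matrix.of fun i j => M (s.1, i) (t.1, j))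
      (Matrix.of fun i j => N (s.1, i) (t.1, j))) s.2 t.2
  map_smul' c M := by
    ext s t
    exact congrFun₂ (map_smul Φ c (Matrix.of fun i j => M (s.1, i) (t.1, j))) s.2 t.2

theorem submatrix_idTensorLinearMap (Φ : Matrix n n ℂ →ₗ[ℂ] Matrix m m ℂ)
    (M : Matrix (r × n) (r × n) ℂ) (s t : r) :
    (idTensorLinearMap r Φ M).submatrix (Prod.mk s) (Prod.mk t) =
      Φ (M.submatrix (Prod.mk s) (Prod.mk t)) :=
  rfl

theorem ext_submatrix {M N : Matrix (r × n) (r × n) ℂ}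
    (h : ∀ s t, M.submatrix (Prod.mk s) (Prod.mk t) = N.submatrix (Prod.mk s) (Prod.mk t)) :
    M = N :=
  Matrix.ext fun s t => congrFun₂ (h s.1 t.1) s.2 t.2

theorem idTensor_cqState {N : ℕ} (Φ : Matrix n n ℂ →ₗ[ℂ] Matrix m m ℂ) (p : Fin N → ℝ)
    (ρ : Fin N → Matrix n n ℂ) :
    idTensor (Fin N) Φ (cqState p ρ) = cqState p fun x => Φ (ρ x) := by
  change idTensorLinearMap (Fin N) Φ _ = _
  simp only [cqState, map_sum, map_smul]
  exact Finset.sum_congr rfl fun x _ => congrArg _ (idTensor_kronecker _ _ _ _)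

theorem isClosed_setOf_posSemidef [Finite n] : IsClosed {M : Matrix n n ℂ | M.PosSemidef} := by
  have := Fintype.ofFinite n
  simp only [Matrix.posSemidef_iff_dotProduct_mulVec, Set.ofPred_and, Set.ofPred_forall]
  refine (isClosed_eq (by fun_prop) continuous_id).inter (isClosed_iInter fun x => ?_)
  exact isClosed_le continuous_const (by fun_prop)

variable [Fintype n] [Fintype m]

namespace IsQuantumChannel

variable {Φ : Matrix n n ℂ →ₗ[ℂ] Matrix m m ℂ}

theorem posSemidef_idTensor [Finite r] (hΦ : IsQuantumChannel Φ) {M : Matrix (r × n) (r × n) ℂ}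
    (hM : M.PosSemidef) : (idTensor r Φ M).PosSemidef := by
  have := Fintype.ofFinite r
  have h := (hΦ.completelyPositive _ _
    (hM.submatrix (Prod.map (Fintype.equivFin r).symm id))).submatrix
      (Prod.map (Fintype.equivFin r) id)
  convert h using 1
  ext s t
  simp [idTensor]

theorem posSemidef_map (hΦ : IsQuantumChannel Φ) {M : Matrix n n ℂ} (hM : M.PosSemidef) :
    (Φ M).PosSemidef :=
  (hΦ.posSemidef_idTensor (r := Unit) (hM.submatrix Prod.snd)).submatrix (Prod.mk ())

theorem isState_map (hΦ : IsQuantumChannel Φ) {ρ : Matrix n n ℂ} (hρ : IsState ρ) :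
    IsState (Φ ρ) :=
  ⟨hΦ.posSemidef_map hρ.1, (hΦ.tracePreserving ρ).trans hρ.2⟩

theorem map_le (hΦ : IsQuantumChannel Φ) {X Y : Matrix n n ℂ} (h : X ≤ Y) : Φ X ≤ Φ Y := by
  rw [Matrix.le_iff] at h ⊢
  simpa only [map_sub] using hΦ.posSemidef_map h

theorem idTensor [Fintype r] (hΦ : IsQuantumChannel Φ) :
    IsQuantumChannel (idTensorLinearMap r Φ) where
  completelyPositive k _ hM :=
    (hΦ.posSemidef_idTensor (hM.submatrix (Equiv.prodAssoc (Fin k) r n))).submatrix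
      (Equiv.prodAssoc (Fin k) r m).symm
  tracePreserving M := by
    simp only [Matrix.trace, Matrix.diag, Fintype.sum_prod_type]
    exact Finset.sum_congr rfl fun s _ =>
      hΦ.tracePreserving (Matrix.of fun i j => M (s, i) (s, j))

theorem pow {Φ : Matrix n n ℂ →ₗ[ℂ] Matrix n n ℂ} (hΦ : IsQuantumChannel Φ) (k : ℕ) :
    IsQuantumChannel (Φ ^ k) := by
  induction k with
  | zero => exact ⟨fun _ _ hM => hM, fun _ => rfl⟩
  | succ k ih =>
    rw [pow_succ']
    exact ⟨fun l M hM => hΦ.completelyPositive l _ (ih.completelyPositive l M hM),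
      fun X => (hΦ.tracePreserving _).trans (ih.tracePreserving X)⟩

theorem of_tendsto {α : Type*} {l : Filter α} [l.NeBot] {Ψ : α → Matrix n n ℂ →ₗ[ℂ] Matrix m m ℂ}
    (hΨ : ∀ i, IsQuantumChannel (Ψ i)) (h : ∀ X, Tendsto (fun i => Ψ i X) l (𝓝 (Φ X))) :
    IsQuantumChannel Φ where
  completelyPositive k M hM := by
    have hlim : Tendsto (fun i => QInfo.idTensor (Fin k) (Ψ i) M) l
        (𝓝 (QInfo.idTensor (Fin k) Φ M)) :=
      tendsto_pi_nhds.2 fun s => tendsto_pi_nhds.2 fun t =>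
        tendsto_pi_nhds.1 (tendsto_pi_nhds.1
          (h (Matrix.of fun i j => M (s.1, i) (t.1, j))) s.2) t.2
    exact isClosed_setOf_posSemidef.mem_of_tendsto hlim
      (Eventually.of_forall fun i => (hΨ i).completelyPositive k M hM)
  tracePreserving X := by
    have hcont : Continuous fun A : Matrix m m ℂ => A.trace := by fun_prop
    refine tendsto_nhds_unique ((hcont.tendsto _).comp (h X)) ?_
    simp only [Function.comp_def, (hΨ _).tracePreserving, tendsto_const_nhds]

end IsQuantumChannel

namespace IsPeripheralProjection

variable {Φ P : Matrix n n ℂ →ₗ[ℂ] Matrix n n ℂ}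

theorem isQuantumChannel (hP : IsPeripheralProjection Φ P) (hΦ : IsQuantumChannel Φ) :
    IsQuantumChannel P :=
  let ⟨_, _, he⟩ := hP.exists_tendsto
  .of_tendsto (fun _ => hΦ.pow _) he

omit [Fintype n] in
theorem isProj (hP : IsPeripheralProjection Φ P) : LinearMap.IsProj (peripheralSubspace Φ) P :=
  ⟨fun X => hP.range_eq ▸ LinearMap.mem_range_self P X, hP.fixes⟩

end IsPeripheralProjection

end Channels

section BlockOperators

theorem posSemidef_blockDiagonal'_iff {ι : Type*} {g : ι → Type*} [Finite ι] [DecidableEq ι]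
    [∀ k, Finite (g k)] {M : ∀ k, Matrix (g k) (g k) ℂ} :
    (Matrix.blockDiagonal' M).PosSemidef ↔ ∀ k, (M k).PosSemidef := by
  have := Fintype.ofFinite ι
  have (k : ι) := Fintype.ofFinite (g k)
  refine ⟨fun h k => ?_, fun h => ?_⟩
  · rw [← Matrix.blockDiag'_blockDiagonal' M]
    exact h.submatrix (Sigma.mk k)
  · classical
    choose B hB using fun k => CStarAlgebra.nonneg_iff_eq_star_mul_self.1
      (Matrix.nonneg_iff_posSemidef.2 (h k))
    have hMB : Matrix.blockDiagonal' M =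
        (Matrix.blockDiagonal' B)ᴴ * Matrix.blockDiagonal' B := by
      rw [Matrix.blockDiagonal'_conjTranspose, ← Matrix.blockDiagonal'_mul]
      exact congrArg _ (funext hB)
    rw [hMB]
    exact Matrix.posSemidef_conjTranspose_mul_self _

variable {a ι : Type*} {e f : ι → Type*} [Fintype ι] [DecidableEq ι] [∀ k, Fintype (e k)]
  [∀ k, Fintype (f k)]

/-- The operator `0 ⊕ ⨁ k, X k ⊗ ω k` as a linear function of the family `X`. As in
`blockSubspace`, the decomposition of the space is given by an isometry `V`. -/
def blockEmbed (V : Matrix a (Σ k, e k × f k) ℂ) (ω : ∀ k, Matrix (f k) (f k) ℂ) :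
    (∀ k, Matrix (e k) (e k) ℂ) →ₗ[ℂ] Matrix a a ℂ where
  toFun X := V * Matrix.blockDiagonal' (fun k => X k ⊗ₖ ω k) * Vᴴ
  map_add' X Y := by
    simp only [Pi.add_apply, Matrix.add_kronecker]
    rw [← Matrix.add_mul, ← Matrix.mul_add, ← Matrix.blockDiagonal'_add]
    rfl
  map_smul' c X := by
    simp only [Pi.smul_apply, Matrix.smul_kronecker, RingHom.id_apply]
    rw [← Matrix.smul_mul, ← Matrix.mul_smul, ← Matrix.blockDiagonal'_smul]
    rfl

theorem blockEmbed_apply (V : Matrix a (Σ k, e k × f k) ℂ) (ω : ∀ k, Matrix (f k) (f k) ℂ)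
    (X : ∀ k, Matrix (e k) (e k) ℂ) :
    blockEmbed V ω X = V * Matrix.blockDiagonal' (fun k => X k ⊗ₖ ω k) * Vᴴ :=
  rfl

theorem coe_range_blockEmbed {K : ℕ} {d m : Fin K → ℕ}
    (V : Matrix a (Σ k, Fin (d k) × Fin (m k)) ℂ) (ω : ∀ k, Matrix (Fin (m k)) (Fin (m k)) ℂ) :
    (LinearMap.range (blockEmbed V ω) : Set (Matrix a a ℂ)) = blockSubspace V ω :=
  Set.ext fun _ => exists_congr fun _ => eq_comm

section Isometry

variable [Fintype a] [∀ k, DecidableEq (e k)] [∀ k, DecidableEq (f k)]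
  {V : Matrix a (Σ k, e k × f k) ℂ} {ω : ∀ k, Matrix (f k) (f k) ℂ}

theorem trace_blockEmbed (hV : Vᴴ * V = 1) (hω : ∀ k, (ω k).trace = 1)
    (X : ∀ k, Matrix (e k) (e k) ℂ) :
    (blockEmbed V ω X).trace = (Matrix.blockDiagonal' X).trace := by
  simp only [blockEmbed_apply, trace_conj_of_isometry hV, Matrix.trace_blockDiagonal',
    Matrix.trace_kronecker, hω, mul_one]

theorem posSemidef_blockEmbed_iff (hV : Vᴴ * V = 1) (hω : ∀ k, IsState (ω k))
    {X : ∀ k, Matrix (e k) (e k) ℂ} :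
    (blockEmbed V ω X).PosSemidef ↔ (Matrix.blockDiagonal' X).PosSemidef := by
  rw [posSemidef_blockDiagonal'_iff]
  refine ⟨fun h k => ?_, fun h => ?_⟩
  · have hconj := h.conjTranspose_mul_mul_same V
    rw [blockEmbed_apply, ← Matrix.mul_assoc, ← Matrix.mul_assoc, hV, Matrix.one_mul,
      Matrix.mul_assoc, hV, Matrix.mul_one, posSemidef_blockDiagonal'_iff] at hconj
    simpa only [marginalA_kronecker, (hω k).2, one_smul] using posSemidef_marginalA (hconj k)
  · exact (posSemidef_blockDiagonal'_iff.2 fun k =>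
      (h k).kronecker (hω k).1).mul_mul_conjTranspose_same V

theorem isState_blockEmbed_iff (hV : Vᴴ * V = 1) (hω : ∀ k, IsState (ω k))
    {X : ∀ k, Matrix (e k) (e k) ℂ} :
    IsState (blockEmbed V ω X) ↔ IsState (Matrix.blockDiagonal' X) := by
  rw [IsState, IsState, posSemidef_blockEmbed_iff hV hω, trace_blockEmbed hV fun k => (hω k).2]

theorem entropy_blockEmbed [DecidableEq a] (hV : Vᴴ * V = 1) (hω : ∀ k, IsState (ω k))
    {X : ∀ k, Matrix (e k) (e k) ℂ} (hX : ∀ k, (X k).IsHermitian) :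
    entropy (blockEmbed V ω X) =
      entropy (Matrix.blockDiagonal' X) + ∑ k, (X k).trace.re * entropy (ω k) := by
  have hherm (k : ι) : (X k ⊗ₖ ω k).IsHermitian := by
    rw [Matrix.IsHermitian, Matrix.conjTranspose_kronecker, hX k, (hω k).1.1]
  rw [blockEmbed_apply,
    entropy_conj_of_isometry hV (Matrix.isHermitian_blockDiagonal'_iff.2 hherm),
    entropy_blockDiagonal' hherm, entropy_blockDiagonal' hX, ← Finset.sum_add_distrib]
  refine Finset.sum_congr rfl fun k _ => ?_
  rw [entropy_kronecker (hX k) (hω k).1.1, (hω k).2, Complex.one_re, one_mul]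

end Isometry

section Ampliation

variable {r : Type*} [DecidableEq r]

/-- Absorbs a reference system into the first tensor factor of every block. -/
def ampliateEquiv (r : Type*) (e f : ι → Type*) :
    (Σ k, (r × e k) × f k) ≃ r × Σ k, e k × f k where
  toFun s := (s.2.1.1, ⟨s.1, s.2.1.2, s.2.2⟩)
  invFun s := ⟨s.2.1, (s.1, s.2.2.1), s.2.2.2⟩

/-- The isometry `1_r ⊗ V`, viewed as a decomposition of the space enlarged by the reference
system `r` into the blocks `(ℂ^r ⊗ ℂ^(e k)) ⊗ ℂ^(f k)`. -/
def ampliate (r : Type*) [DecidableEq r] (V : Matrix a (Σ k, e k × f k) ℂ) :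
    Matrix (r × a) (Σ k, (r × e k) × f k) ℂ :=
  ((1 : Matrix r r ℂ) ⊗ₖ V).submatrix id (ampliateEquiv r e f)

omit [Fintype ι] [∀ k, Fintype (e k)] [∀ k, Fintype (f k)] in
theorem ampliate_isometry [Fintype r] [Fintype a] [∀ k, DecidableEq (e k)]
    [∀ k, DecidableEq (f k)] {V : Matrix a (Σ k, e k × f k) ℂ} (hV : Vᴴ * V = 1) :
    (ampliate r V)ᴴ * ampliate r V = 1 := by
  rw [ampliate, Matrix.conjTranspose_submatrix,
    ← Matrix.submatrix_mul _ _ _ _ _ Function.bijective_id, Matrix.conjTranspose_kronecker,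
    ← Matrix.mul_kronecker_mul, hV, Matrix.conjTranspose_one, one_mul, Matrix.one_kronecker_one,
    Matrix.submatrix_one_equiv]

variable [Fintype r]

theorem submatrix_blockEmbed_ampliate (V : Matrix a (Σ k, e k × f k) ℂ)
    (ω : ∀ k, Matrix (f k) (f k) ℂ) (X : ∀ k, Matrix (r × e k) (r × e k) ℂ) (s t : r) :
    (blockEmbed (ampliate r V) ω X).submatrix (Prod.mk s) (Prod.mk t) =
      blockEmbed V ω fun k => (X k).submatrix (Prod.mk s) (Prod.mk t) := by
  have hblock (p q : Σ k, e k × f k) :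
      Matrix.blockDiagonal' (fun k => X k ⊗ₖ ω k) ((ampliateEquiv r e f).symm (s, p))
        ((ampliateEquiv r e f).symm (t, q)) =
        Matrix.blockDiagonal' (fun k => (X k).submatrix (Prod.mk s) (Prod.mk t) ⊗ₖ ω k) p q := by
    obtain ⟨k, x⟩ := p
    obtain ⟨l, y⟩ := q
    rcases eq_or_ne k l with rfl | hkl
    · simp [ampliateEquiv, Matrix.blockDiagonal'_apply_eq]
    · simp [ampliateEquiv, Matrix.blockDiagonal'_apply_ne _ _ _ hkl]
  ext i j
  simp only [blockEmbed_apply, Matrix.submatrix_apply, Matrix.mul_apply,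
    Matrix.conjTranspose_apply, ← (ampliateEquiv r e f).symm.sum_comp, Fintype.sum_prod_type]
  simp [ampliate, Matrix.one_apply, apply_ite (starRingEnd ℂ), Finset.sum_ite_irrel, hblock]

theorem marginalB_blockEmbed_ampliate (V : Matrix a (Σ k, e k × f k) ℂ)
    (ω : ∀ k, Matrix (f k) (f k) ℂ) (X : ∀ k, Matrix (r × e k) (r × e k) ℂ) :
    marginalB (blockEmbed (ampliate r V) ω X) = blockEmbed V ω fun k => marginalB (X k) := by
  simp only [marginalB_eq_sum_submatrix, submatrix_blockEmbed_ampliate, ← map_sum]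
  congr 1
  ext k : 1
  rw [Finset.sum_apply]

theorem isProj_idTensor {V : Matrix a (Σ k, e k × f k) ℂ} {ω : ∀ k, Matrix (f k) (f k) ℂ}
    {P : Matrix a a ℂ →ₗ[ℂ] Matrix a a ℂ}
    (hP : LinearMap.IsProj (LinearMap.range (blockEmbed V ω)) P) :
    LinearMap.IsProj (LinearMap.range (blockEmbed (ampliate r V) ω)) (idTensorLinearMap r P) where
  map_mem M := by
    choose X hX using fun s t => hP.map_mem (M.submatrix (Prod.mk s) (Prod.mk t))
    refine ⟨fun k => Matrix.of fun p q => X p.1 q.1 k p.2 q.2, ?_⟩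
    refine ext_submatrix fun s t => ?_
    rw [submatrix_blockEmbed_ampliate, submatrix_idTensorLinearMap, ← hX]
    rfl
  map_id := by
    rintro _ ⟨X, rfl⟩
    refine ext_submatrix fun s t => ?_
    rw [submatrix_idTensorLinearMap, submatrix_blockEmbed_ampliate]
    exact hP.map_id _ ⟨_, rfl⟩

theorem stateCoherentInformation_blockEmbed [Fintype a] [DecidableEq a] [∀ k, DecidableEq (e k)]
    [∀ k, DecidableEq (f k)] {V : Matrix a (Σ k, e k × f k) ℂ} (hV : Vᴴ * V = 1)
    {ω : ∀ k, Matrix (f k) (f k) ℂ} (hω : ∀ k, IsState (ω k))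
    {X : ∀ k, Matrix (r × e k) (r × e k) ℂ} (hX : ∀ k, (X k).PosSemidef) :
    stateCoherentInformation (blockEmbed (ampliate r V) ω X) =
      ∑ k, stateCoherentInformation (X k) := by
  have hmarg (k : ι) : (marginalB (X k)).IsHermitian := (posSemidef_marginalB (hX k)).1
  have hherm (k : ι) : (X k).IsHermitian := (hX k).1
  simp only [stateCoherentInformation, marginalB_blockEmbed_ampliate,
    entropy_blockEmbed hV hω hmarg, entropy_blockEmbed (ampliate_isometry hV) hω hherm,
    entropy_blockDiagonal' hmarg, entropy_blockDiagonal' hherm, trace_marginalB,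
    Finset.sum_sub_distrib]
  ring

end Ampliation

end BlockOperators

section Holevo

section ClassicalQuantum

variable {N : ℕ} {n : Type*}

theorem cqState_eq_submatrix_blockDiagonal' (p : Fin N → ℝ) (ρ : Fin N → Matrix n n ℂ) :
    cqState p ρ = (Matrix.blockDiagonal' fun x => (p x : ℂ) • ρ x).submatrix
      (Equiv.sigmaEquivProd (Fin N) n).symm (Equiv.sigmaEquivProd (Fin N) n).symm := by
  ext ⟨x, i⟩ ⟨y, j⟩
  simp only [cqState, Matrix.sum_apply, Matrix.smul_apply, Matrix.kroneckerMap_apply,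
    Matrix.submatrix_apply, Equiv.sigmaEquivProd_symm_apply, smul_eq_mul]
  rw [Finset.sum_eq_single x (fun z _ hz => by simp [hz]) (by simp)]
  rcases eq_or_ne x y with rfl | hxy
  · simp [Matrix.blockDiagonal'_apply_eq]
  · simp [Matrix.blockDiagonal'_apply_ne _ _ _ hxy, hxy]

theorem marginalA_cqState [Fintype n] (p : Fin N → ℝ) {ρ : Fin N → Matrix n n ℂ}
    (hρ : ∀ x, (ρ x).trace = 1) :
    marginalA (cqState p ρ) = Matrix.diagonal fun x => (p x : ℂ) := by
  ext x y
  rw [cqState_eq_submatrix_blockDiagonal']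
  rcases eq_or_ne x y with rfl | hxy
  · have hsum : ∑ i, ρ x i i = 1 := hρ x
    simp [marginalA, Matrix.blockDiagonal'_apply_eq, ← Finset.mul_sum, hsum]
  · simp [marginalA, Matrix.blockDiagonal'_apply_ne _ _ _ hxy, hxy]

theorem marginalB_cqState (p : Fin N → ℝ) (ρ : Fin N → Matrix n n ℂ) :
    marginalB (cqState p ρ) = ∑ x, (p x : ℂ) • ρ x := by
  ext i j
  simp [cqState_eq_submatrix_blockDiagonal', marginalB, Matrix.sum_apply,
    Matrix.blockDiagonal'_apply_eq]

variable [Fintype n] [DecidableEq n]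

theorem entropy_cqState (p : Fin N → ℝ) {ρ : Fin N → Matrix n n ℂ} (hρ : ∀ x, IsState (ρ x)) :
    entropy (cqState p ρ) = ∑ x, (Real.negMulLog (p x) + p x * entropy (ρ x)) := by
  have hherm (x : Fin N) : ((p x : ℂ) • ρ x).IsHermitian := by
    rw [Matrix.IsHermitian, Matrix.conjTranspose_smul, (hρ x).1.1, Complex.star_def,
      Complex.conj_ofReal]
  rw [cqState_eq_submatrix_blockDiagonal',
    entropy_submatrix_equiv (Matrix.isHermitian_blockDiagonal'_iff.2 hherm),
    entropy_blockDiagonal' hherm]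
  refine Finset.sum_congr rfl fun x _ => ?_
  rw [entropy_smul (hρ x).1.1, (hρ x).2, Complex.one_re, one_mul]

theorem mutualInformation_cqState (p : Fin N → ℝ) {ρ : Fin N → Matrix n n ℂ}
    (hρ : ∀ x, IsState (ρ x)) :
    mutualInformation (cqState p ρ) =
      entropy (∑ x, (p x : ℂ) • ρ x) - ∑ x, p x * entropy (ρ x) := by
  rw [mutualInformation, marginalA_cqState p fun x => (hρ x).2, marginalB_cqState,
    entropy_cqState p hρ, entropy_diagonal, Finset.sum_add_distrib]
  ring

omit [DecidableEq n] in
theorem Ensemble.isState_average (E : Ensemble N n) :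
    IsState (∑ x, (E.p x : ℂ) • E.ρ x) := by
  refine ⟨Matrix.posSemidef_sum _ fun x _ =>
    (E.ρ_isState x).1.smul (Complex.zero_le_real.2 (E.p_nonneg x)), ?_⟩
  simp only [Matrix.trace_sum, Matrix.trace_smul, (E.ρ_isState _).2, smul_eq_mul, mul_one]
  exact_mod_cast E.p_sum

theorem Ensemble.mutualInformation_le_log_card (E : Ensemble N n) :
    mutualInformation (cqState E.p E.ρ) ≤ Real.log (Fintype.card n) := by
  rw [mutualInformation_cqState _ E.ρ_isState]
  have hnonneg : 0 ≤ ∑ x, E.p x * entropy (E.ρ x) :=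
    Finset.sum_nonneg fun x _ => mul_nonneg (E.p_nonneg x) (E.ρ_isState x).entropy_nonneg
  exact (sub_le_self _ hnonneg).trans E.isState_average.entropy_le_log_card

/-- The ensemble of the computational basis states of `ℂ^n`, all with the same probability. -/
noncomputable def uniformBasisEnsemble (n : Type*) [Fintype n] [DecidableEq n] [Nonempty n] :
    Ensemble (Fintype.card n) n where
  p _ := (Fintype.card n : ℝ)⁻¹
  p_nonneg _ := by positivity
  p_sum := by simp
  ρ x := Matrix.single ((Fintype.equivFin n).symm x) ((Fintype.equivFin n).symm x) 1
  ρ_isState _ := (isPureState_single _).isState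

theorem mutualInformation_uniformBasisEnsemble [Nonempty n] :
    mutualInformation (cqState (uniformBasisEnsemble n).p (uniformBasisEnsemble n).ρ) =
      Real.log (Fintype.card n) := by
  have hentropy (x) : entropy ((uniformBasisEnsemble n).ρ x) = 0 :=
    (isPureState_single _).entropy_eq_zero
  have haverage : ∑ x, ((uniformBasisEnsemble n).p x : ℂ) • (uniformBasisEnsemble n).ρ x =
      (Fintype.card n : ℂ)⁻¹ • 1 := by
    simp only [uniformBasisEnsemble, ← Finset.smul_sum]
    rw [(Fintype.equivFin n).symm.sum_comp fun i => Matrix.single i i (1 : ℂ),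
      Matrix.sum_single_one, Complex.ofReal_inv, Complex.ofReal_natCast]
  rw [mutualInformation_cqState _ (uniformBasisEnsemble n).ρ_isState, haverage,
    entropy_maximallyMixed]
  simp only [hentropy, mul_zero, Finset.sum_const_zero, sub_zero]

end ClassicalQuantum

variable {n ι : Type*} {e f : ι → Type*} [Fintype n] [DecidableEq n] [Fintype ι] [DecidableEq ι]
  [∀ k, Fintype (e k)] [∀ k, Fintype (f k)] [∀ k, DecidableEq (e k)] [∀ k, DecidableEq (f k)]
  {P : Matrix n n ℂ →ₗ[ℂ] Matrix n n ℂ} {V : Matrix n (Σ k, e k × f k) ℂ}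
  {ω : ∀ k, Matrix (f k) (f k) ℂ}

theorem mutualInformation_cqState_blockEmbed (hV : Vᴴ * V = 1) (hω : ∀ k, IsState (ω k)) {N : ℕ}
    (p : Fin N → ℝ) {X : Fin N → ∀ k, Matrix (e k) (e k) ℂ}
    (hX : ∀ x, IsState (Matrix.blockDiagonal' (X x))) :
    mutualInformation (cqState p fun x => blockEmbed V ω (X x)) =
      mutualInformation (cqState p fun x => Matrix.blockDiagonal' (X x)) := by
  have hherm (x : Fin N) (k : ι) : (X x k).IsHermitian :=
    Matrix.isHermitian_blockDiagonal'_iff.1 (hX x).1.1 k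
  have hherm_sum (k : ι) : ((∑ x, (p x : ℂ) • X x) k).IsHermitian := by
    simp only [Finset.sum_apply, Pi.smul_apply]
    refine isSelfAdjoint_sum _ fun x _ => ?_
    exact IsSelfAdjoint.smul (Complex.conj_ofReal _) (hherm x k)
  have hsum : ∑ x, (p x : ℂ) • Matrix.blockDiagonal' (X x) =
      Matrix.blockDiagonal' (∑ x, (p x : ℂ) • X x) := by
    simp only [← Matrix.blockDiagonal'_smul]
    exact (map_sum (Matrix.blockDiagonal'AddMonoidHom e e ℂ) _ _).symm
  have hcancel : ∑ k, ((∑ x, (p x : ℂ) • X x) k).trace.re * entropy (ω k) =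
      ∑ x, p x * ∑ k, (X x k).trace.re * entropy (ω k) := by
    simp only [Finset.sum_apply, Pi.smul_apply, Matrix.trace_sum, Matrix.trace_smul, smul_eq_mul,
      Complex.re_sum, Complex.re_ofReal_mul, Finset.sum_mul, Finset.mul_sum, mul_assoc]
    exact Finset.sum_comm
  rw [mutualInformation_cqState p fun x => (isState_blockEmbed_iff hV hω).2 (hX x),
    mutualInformation_cqState p hX, hsum]
  simp only [← map_smul, ← map_sum, entropy_blockEmbed hV hω hherm_sum,
    entropy_blockEmbed hV hω (hherm _), hcancel, mul_add, Finset.sum_add_distrib]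
  ring

theorem holevoQuantity_le (hP : IsQuantumChannel P) (hV : Vᴴ * V = 1) (hω : ∀ k, IsState (ω k))
    (hproj : LinearMap.IsProj (LinearMap.range (blockEmbed V ω)) P) :
    holevoQuantity P ≤ ((Real.log (Fintype.card (Σ k, e k)) : ℝ) : EReal) := by
  refine iSup₂_le fun N E => EReal.coe_le_coe_iff.2 ?_
  choose X hX using fun x => hproj.map_mem (E.ρ x)
  have hstate (x : Fin N) : IsState (Matrix.blockDiagonal' (X x)) := by
    rw [← isState_blockEmbed_iff hV hω, hX]
    exact hP.isState_map (E.ρ_isState x)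
  let F : Ensemble N (Σ k, e k) := { E with
    ρ := fun x => Matrix.blockDiagonal' (X x)
    ρ_isState := hstate }
  rw [idTensor_cqState]
  simp only [← hX]
  rw [mutualInformation_cqState_blockEmbed hV hω E.p hstate]
  exact F.mutualInformation_le_log_card

theorem le_holevoQuantity [Nonempty (Σ k, e k)] (hV : Vᴴ * V = 1) (hω : ∀ k, IsState (ω k))
    (hproj : LinearMap.IsProj (LinearMap.range (blockEmbed V ω)) P) :
    ((Real.log (Fintype.card (Σ k, e k)) : ℝ) : EReal) ≤ holevoQuantity P := by
  let F := uniformBasisEnsemble (Σ k, e k)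
  have hblock (x) : Matrix.blockDiagonal' (Matrix.blockDiag' (F.ρ x)) = F.ρ x := by
    change Matrix.blockDiagonal' (Matrix.blockDiag' (Matrix.single _ _ 1)) = Matrix.single _ _ 1
    rw [← Matrix.diagonal_single, funext (Matrix.blockDiag'_diagonal _),
      Matrix.blockDiagonal'_diagonal]
  have hstate (x) : IsState (Matrix.blockDiagonal' (Matrix.blockDiag' (F.ρ x))) := by
    rw [hblock]
    exact F.ρ_isState x
  let E : Ensemble _ n := { F with
    ρ := fun x => blockEmbed V ω (Matrix.blockDiag' (F.ρ x))
    ρ_isState := fun x => (isState_blockEmbed_iff hV hω).2 (hstate x) }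
  have hfixed (x) : P (E.ρ x) = E.ρ x := hproj.map_id _ ⟨_, rfl⟩
  refine le_iSup₂_of_le _ E (EReal.coe_le_coe_iff.2 (le_of_eq ?_))
  rw [idTensor_cqState]
  simp only [hfixed]
  rw [mutualInformation_cqState_blockEmbed hV hω F.p hstate]
  simp only [hblock]
  exact mutualInformation_uniformBasisEnsemble.symm

end Holevo

section CoherentInformation

section Bipartite

variable {r b : Type*} [Fintype r] [DecidableEq r] [Fintype b] [DecidableEq b]

theorem stateCoherentInformation_le {M : Matrix (r × b) (r × b) ℂ} (hM : M.PosSemidef) :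
    stateCoherentInformation M ≤ M.trace.re * Real.log (Fintype.card b) := by
  have hupper := entropy_le_negMulLog_trace_add (posSemidef_marginalB hM)
  rw [trace_marginalB] at hupper
  have hlower := negMulLog_trace_le_entropy hM
  rw [stateCoherentInformation]
  linarith

theorem exists_isPureState_stateCoherentInformation_eq [Nonempty b]
    (h : Fintype.card b ≤ Fintype.card r) :
    ∃ ρ : Matrix (r × b) (r × b) ℂ,
      IsPureState ρ ∧ stateCoherentInformation ρ = Real.log (Fintype.card b) := by
  obtain ⟨g⟩ := Function.Embedding.nonempty_of_card_le h
  let v : r × b → ℂ := fun s => if s.1 = g s.2 then 1 else 0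
  have hnorm : star v ⬝ᵥ v = Fintype.card b := by
    simp [v, dotProduct, Fintype.sum_prod_type_right]
  have hv : v ≠ 0 := by
    rintro hv
    simp [hv, eq_comm] at hnorm
  have hpure := isPureState_inv_smul_vecMulVec hv
  refine ⟨_, hpure, ?_⟩
  have hmarginal : marginalB ((star v ⬝ᵥ v)⁻¹ • Matrix.vecMulVec v (star v)) =
      (Fintype.card b : ℂ)⁻¹ • 1 := by
    ext i j
    simp [marginalB, hnorm, v, Matrix.vecMulVec_apply, Matrix.one_apply, @eq_comm _ j i]
  rw [stateCoherentInformation, hpure.entropy_eq_zero, hmarginal, entropy_maximallyMixed, sub_zero]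

end Bipartite

theorem card_le_card_of_conjTranspose_mul_self_eq_one {a b : Type*} [Fintype a] [Fintype b]
    [DecidableEq b] {A : Matrix a b ℂ} (hA : Aᴴ * A = 1) : Fintype.card b ≤ Fintype.card a := by
  have h := (Matrix.rank_mul_le_right Aᴴ A).trans (Matrix.rank_le_card_height A)
  rwa [hA, Matrix.rank_one] at h

variable {n ι : Type*} {e f : ι → Type*} [Fintype n] [Fintype ι] [DecidableEq ι]
  [∀ k, Fintype (e k)] [∀ k, Fintype (f k)] [∀ k, DecidableEq (e k)] [∀ k, DecidableEq (f k)]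
  {P : Matrix n n ℂ →ₗ[ℂ] Matrix n n ℂ} {V : Matrix n (Σ k, e k × f k) ℂ}
  {ω : ∀ k, Matrix (f k) (f k) ℂ}

theorem exists_isPureState_map_eq (hP : IsQuantumChannel P) (hV : Vᴴ * V = 1)
    (hω : ∀ k, IsState (ω k)) (hproj : LinearMap.IsProj (LinearMap.range (blockEmbed V ω)) P)
    {X₀ : ∀ k, Matrix (e k) (e k) ℂ} (hX₀ : IsPureState (Matrix.blockDiagonal' X₀)) :
    ∃ τ, IsPureState τ ∧ P τ = blockEmbed V ω X₀ := by
  obtain ⟨τ, hτ, c, hle⟩ := ((isState_blockEmbed_iff hV hω).2 hX₀.isState).exists_isPureState_le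
  obtain ⟨X, hX⟩ := hproj.map_mem τ
  have hstate : IsState (Matrix.blockDiagonal' X) := by
    rw [← isState_blockEmbed_iff hV hω, hX]
    exact hP.isState_map hτ.isState
  have hPle : blockEmbed V ω X ≤ c • blockEmbed V ω X₀ := by
    simpa only [map_smul, hproj.map_id _ ⟨X₀, rfl⟩, hX] using hP.map_le hle
  have hXle : Matrix.blockDiagonal' X ≤ c • Matrix.blockDiagonal' X₀ := by
    rw [Matrix.le_iff, ← map_smul, ← map_sub, posSemidef_blockEmbed_iff hV hω,
      Matrix.blockDiagonal'_sub, Matrix.blockDiagonal'_smul] at hPle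
    exact hPle
  exact ⟨τ, hτ, by rw [← hX, Matrix.blockDiagonal'_injective (hX₀.eq_of_le hstate hXle)]⟩

variable [DecidableEq n]

theorem coherentInformation_le (hP : IsQuantumChannel P) (hV : Vᴴ * V = 1)
    (hω : ∀ k, IsState (ω k)) (hproj : LinearMap.IsProj (LinearMap.range (blockEmbed V ω)) P)
    {D : ℕ} (hD : ∀ k, Fintype.card (e k) ≤ D) :
    coherentInformation P ≤ ((Real.log D : ℝ) : EReal) := by
  refine iSup₂_le fun ρ hρ => EReal.coe_le_coe_iff.2 ?_
  have hlog (k : ι) : Real.log (Fintype.card (e k)) ≤ Real.log D := by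
    rcases Nat.eq_zero_or_pos (Fintype.card (e k)) with h | h
    · rw [h, Nat.cast_zero, Real.log_zero]
      exact Real.log_natCast_nonneg D
    · exact Real.log_le_log (Nat.cast_pos.2 h) (Nat.cast_le.2 (hD k))
  obtain ⟨X, hX⟩ := (isProj_idTensor (r := n) hproj).map_mem ρ
  have hstate : IsState (Matrix.blockDiagonal' X) := by
    rw [← isState_blockEmbed_iff (ampliate_isometry hV) hω, hX]
    exact hP.idTensor.isState_map hρ.isState
  have hpos := posSemidef_blockDiagonal'_iff.1 hstate.1
  have htrace : ∑ k, (X k).trace.re = 1 := by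
    rw [← Complex.re_sum, ← Matrix.trace_blockDiagonal', hstate.2, Complex.one_re]
  calc stateCoherentInformation (idTensor n P ρ)
      = stateCoherentInformation (blockEmbed (ampliate n V) ω X) := by rw [hX]; rfl
    _ = ∑ k, stateCoherentInformation (X k) := stateCoherentInformation_blockEmbed hV hω hpos
    _ ≤ ∑ k, (X k).trace.re * Real.log D := Finset.sum_le_sum fun k _ =>
        (stateCoherentInformation_le (hpos k)).trans <|
          mul_le_mul_of_nonneg_left (hlog k) (Complex.nonneg_iff.1 (hpos k).trace_nonneg).1
    _ = Real.log D := by rw [← Finset.sum_mul, htrace, one_mul]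

theorem stateCoherentInformation_le_coherentInformation (hP : IsQuantumChannel P)
    (hV : Vᴴ * V = 1) (hω : ∀ k, IsState (ω k))
    (hproj : LinearMap.IsProj (LinearMap.range (blockEmbed V ω)) P) {k : ι}
    {ρ : Matrix (n × e k) (n × e k) ℂ} (hρ : IsPureState ρ) :
    ((stateCoherentInformation ρ : ℝ) : EReal) ≤ coherentInformation P := by
  let X₀ : ∀ l, Matrix (n × e l) (n × e l) ℂ := Pi.single k ρ
  obtain ⟨τ, hτ, hPτ⟩ := exists_isPureState_map_eq hP.idTensor (ampliate_isometry hV) hω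
    (isProj_idTensor hproj) (X₀ := X₀) hρ.blockDiagonal'_single
  have hpos (l : ι) : (X₀ l).PosSemidef :=
    posSemidef_blockDiagonal'_iff.1 hρ.blockDiagonal'_single.isState.1 l
  have hother (l : ι) (hl : l ≠ k) : stateCoherentInformation (X₀ l) = 0 := by
    simp only [X₀, Pi.single_eq_of_ne hl, stateCoherentInformation, marginalB_zero, entropy_zero,
      sub_self]
  refine le_iSup₂_of_le τ hτ (EReal.coe_le_coe_iff.2 (le_of_eq ?_))
  calc stateCoherentInformation ρ
      = stateCoherentInformation (X₀ k) := by simp only [X₀, Pi.single_eq_same]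
    _ = ∑ l, stateCoherentInformation (X₀ l) := (Fintype.sum_eq_single k hother).symm
    _ = stateCoherentInformation (blockEmbed (ampliate n V) ω X₀) :=
        (stateCoherentInformation_blockEmbed hV hω hpos).symm
    _ = stateCoherentInformation (idTensor n P τ) := by rw [← hPτ]; rfl

theorem le_coherentInformation (hP : IsQuantumChannel P) (hV : Vᴴ * V = 1)
    (hω : ∀ k, IsState (ω k)) (hproj : LinearMap.IsProj (LinearMap.range (blockEmbed V ω)) P)
    (k : ι) [Nonempty (e k)] :
    ((Real.log (Fintype.card (e k)) : ℝ) : EReal) ≤ coherentInformation P := by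
  have hcard : Fintype.card (e k) ≤ Fintype.card n := by
    obtain ⟨j⟩ := (hω k).nonempty
    exact (Fintype.card_le_of_injective (fun i => (⟨k, i, j⟩ : Σ k, e k × f k))
      fun i i' h => by simpa using h).trans (card_le_card_of_conjTranspose_mul_self_eq_one hV)
  obtain ⟨ρ, hρ, hρI⟩ := exists_isPureState_stateCoherentInformation_eq hcard
  rw [← hρI]
  exact stateCoherentInformation_le_coherentInformation hP hV hω hproj hρ

end CoherentInformation

end QInfo

theorem mainTheorem5_general {n ι : Type*} {e f : ι → Type*} [Fintype n] [DecidableEq n]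
    [Nonempty n] [Fintype ι] [DecidableEq ι] [∀ k, Fintype (e k)] [∀ k, Fintype (f k)]
    [∀ k, DecidableEq (e k)] [∀ k, DecidableEq (f k)] {P : Matrix n n ℂ →ₗ[ℂ] Matrix n n ℂ}
    (hP : QInfo.IsQuantumChannel P) {V : Matrix n (Σ k, e k × f k) ℂ} (hV : Vᴴ * V = 1)
    {ω : ∀ k, Matrix (f k) (f k) ℂ} (hω : ∀ k, QInfo.IsState (ω k))
    (hproj : LinearMap.IsProj (LinearMap.range (QInfo.blockEmbed V ω)) P) :
    QInfo.holevoQuantity P = ((Real.log (∑ k, (Fintype.card (e k) : ℝ)) : ℝ) : EReal) ∧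
      QInfo.coherentInformation P =
        ((Real.log ((Finset.univ.sup fun k => Fintype.card (e k) : ℕ) : ℝ) : ℝ) : EReal) := by
  obtain ⟨i⟩ := ‹Nonempty n›
  obtain ⟨X, hX⟩ := hproj.map_mem (Matrix.single i i 1)
  have hstate : QInfo.IsState (Matrix.blockDiagonal' X) := by
    rw [← QInfo.isState_blockEmbed_iff hV hω, hX]
    exact hP.isState_map (QInfo.isPureState_single i).isState
  have hne : Nonempty (Σ k, e k) := hstate.nonempty
  obtain ⟨k₀, j₀⟩ := hne.some
  have hle (k : ι) := Finset.le_sup (f := fun k => Fintype.card (e k)) (Finset.mem_univ k)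
  obtain ⟨k, -, hk⟩ := Finset.exists_mem_eq_sup Finset.univ ⟨k₀, Finset.mem_univ k₀⟩
    fun k => Fintype.card (e k)
  have : Nonempty (e k) := Fintype.card_pos_iff.1 <|
    hk ▸ (Fintype.card_pos_iff.2 ⟨j₀⟩).trans_le (hle k₀)
  constructor
  · rw [← Nat.cast_sum, ← Fintype.card_sigma]
    exact (QInfo.holevoQuantity_le hP hV hω hproj).antisymm (QInfo.le_holevoQuantity hV hω hproj)
  · refine (QInfo.coherentInformation_le hP hV hω hproj hle).antisymm ?_
    rw [hk]
    exact QInfo.le_coherentInformation hP hV hω hproj k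

theorem mainTheorem5 {n : Type*} [Fintype n] [DecidableEq n] [Nonempty n]
    (Φ P : Matrix n n ℂ →ₗ[ℂ] Matrix n n ℂ)
    (hΦ : QInfo.IsQuantumChannel Φ) (hP : QInfo.IsPeripheralProjection Φ P)
    {K : ℕ} (d m : Fin K → ℕ)
    (V : Matrix n (Σ k, Fin (d k) × Fin (m k)) ℂ) (hV : Vᴴ * V = 1)
    (ω : ∀ k, Matrix (Fin (m k)) (Fin (m k)) ℂ)
    (hω : ∀ k, (ω k).PosDef ∧ (ω k).trace = 1)
    (hX : (QInfo.peripheralSubspace Φ : Set (Matrix n n ℂ)) = QInfo.blockSubspace V ω) :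
    QInfo.holevoQuantity P = ((Real.log (∑ k, (d k : ℝ)) : ℝ) : EReal) ∧
      QInfo.coherentInformation P =
        ((Real.log ((Finset.univ.sup d : ℕ) : ℝ) : ℝ) : EReal) := by
  have hrange : QInfo.peripheralSubspace Φ = LinearMap.range (QInfo.blockEmbed V ω) :=
    SetLike.coe_injective (hX.trans (QInfo.coe_range_blockEmbed V ω).symm)
  simpa only [Fintype.card_fin] using mainTheorem5_general (hP.isQuantumChannel hΦ) hV
    (fun k => ⟨(hω k).1.posSemidef, (hω k).2⟩) (hrange ▸ hP.isProj)
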